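/- Let $k\ge 2$ be an integer and, for $\lambda>0$, let $$u(x)=e^{-x^2/2}\Big[\lambda+\sqrt{2k-2}\,\mathrm{Erfc}\Big(\sqrt{\tfrac{k-1}{2}}\,x\Big)\Big]^{\frac1{1-k}},\qquad x\in\mathbb R,\qquad \mathrm{Erfc}(t)=\int_t^{+\infty}e^{-v^2}\,dv .$$ Then $u$ is a $C^2$ solution on $\mathbb R$ of the nonlinear harmonic oscillator $$u''-x^2u+u=\Big(\frac{d}{dx}-x\Big)u^k,\qquad u(0)=u_0>0,\qquad \lambda=u_0^{1-k}-\sqrt{\tfrac{\pi(k-1)}{2}} .$$ Call $z_0\in\mathbb C$ a singularity of the holomorphic extension of $u$ if $z_0$ belongs to the closure of some connected open set $D\subset\mathbb C$ containing $\mathbb R$ to which $u$ extends holomorphically, but $u$ extends holomorphically to no connected open set containing $\mathbb R\cup\{z_0\}$. For every $\lambda>0$, except for at most one exceptional value (which may depend on $k$), and for every $\varepsilon>0$, the holomorphic extension $u(z)$ has a sequence of singularities which tends to infinity and is contained in the sector $\pi/4<\arg z<\pi/4+\varepsilon$ or in the sector $3\pi/4-\varepsilon<\arg z<3\pi/4$,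 where $\arg z\in(-\pi,\pi]$. -/

import Mathlib

/-- The (unnormalized) complementary error function `Erfc t = ∫_t^{+∞} e^{-v²} dv` on the
real line. -/
noncomputable def Erfc (t : ℝ) : ℝ := ∫ v in Set.Ioi t, Real.exp (-v ^ 2)

/-- The explicit function
`u(x) = e^{-x²/2} [lam + √(2k-2) Erfc(√((k-1)/2) x)]^{1/(1-k)}`, `x ∈ ℝ`.
For `lam > 0` the bracket is positive, and the real power is the positive root. -/
noncomputable def oscSol (k : ℕ) (lam : ℝ) (x : ℝ) : ℝ :=
  Real.exp (-x ^ 2 / 2) *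
    (lam + Real.sqrt (2 * k - 2) * Erfc (Real.sqrt (((k : ℝ) - 1) / 2) * x)) ^
      (1 / (1 - (k : ℝ)))

/-- `u` is a classical solution on `ℝ` of the nonlinear harmonic oscillator
`u'' - x² u + u = (d/dx - x) u^k`. -/
structure SolvesOscillator (k : ℕ) (u : ℝ → ℝ) : Prop where
  contDiff : ContDiff ℝ 2 u
  eqn : ∀ x : ℝ, deriv (deriv u) x - x ^ 2 * u x + u x =
    deriv (fun t => u t ^ k) x - x * u x ^ k

/-- `g` is a holomorphic extension of `u : ℝ → ℝ` to the domain (connected open set)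
`D ⊆ ℂ`, which contains the real line. -/
structure IsHolomorphicExtension (u : ℝ → ℝ) (D : Set ℂ) (g : ℂ → ℂ) : Prop where
  isOpen : IsOpen D
  isConnected : IsConnected D
  real_mem : ∀ x : ℝ, (x : ℂ) ∈ D
  differentiableOn : DifferentiableOn ℂ g D
  eq_on_real : ∀ x : ℝ, g x = u x

/-- `z₀` is a singularity of the holomorphic extension of `u : ℝ → ℝ`: holomorphic
extension from the real line reaches `z₀` (as a limit point of a domain to which `u` extends),
but `u` extends holomorphically to no domain that contains `z₀`. Poles, branch points and
essential singularities are singularities in this sense. Removable singularities, and points of an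
arbitrarily chosen branch cut across which the function continues holomorphically, are not. -/
def IsSingularity (u : ℝ → ℝ) (z₀ : ℂ) : Prop :=
  (∃ (D : Set ℂ) (g : ℂ → ℂ), IsHolomorphicExtension u D g ∧ z₀ ∈ closure D) ∧
    ∀ (D : Set ℂ) (g : ℂ → ℂ), IsHolomorphicExtension u D g → z₀ ∉ D

/-- The extension of `u` has a sequence of singularities that lie in the open sector
`a < arg z < b` and tend to infinity. -/
def HasSingularitiesToInfinity (u : ℝ → ℝ) (a b : ℝ) : Prop :=
  ∃ z : ℕ → ℂ, (∀ n, IsSingularity u (z n) ∧ a < (z n).arg ∧ (z n).arg < b) ∧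
    Filter.Tendsto (fun n => ‖z n‖) Filter.atTop Filter.atTop

open Set Filter Topology MeasureTheory

/-! With `a = lam / √(2k-2)` and `w = √((k-1)/2) z`, the bracket vanishes exactly when the entire
extension of `Erfc` takes the value `-a` at `w`.

Such zeros are singularities (`isSingularity_of_complexOscBracket_eq_zero`). The identity `u^(k-1) ·
bracket = e^{-(k-1)x²/2}` persists on every domain of extension and fails at a zero, since the right
side never vanishes. Conversely, `u` extends to the dense set of points joined to `ℝ` by zero-free
vertical segments, where the bracket has a holomorphic logarithm, so every zero is a limit point of
a domain of extension.

The zeros come from `complexErfc w = e^{-w²} G(w)` with `G = gaussLaplace` and `G(w) ~ 1/(2w)` in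
sectors inside the right half plane. If `e^{-iR²} = -1`, it suffices to solve `w² - log (G(w)/a) =
iR²`. At `R e^{iπ/4}` the error is only `O(log R)`, while `w²` moves by at least `2R - 1` on the
unit circle about that point, so a quantitative open mapping theorem gives a root within distance 1
(`exists_complexErfc_eq_neg`). At this root `|e^{-w²}| = a/|G(w)| ≥ a|w| > 1`, hence `Re w² < 0` and
the root lies strictly above the diagonal (`pi_div_four_lt_arg`). The first sector thus works for
every `lam > 0`. -/

/-! ### The entire extension of `Erfc` and its asymptotics. -/

/-- The Laplace transform `∫_0^∞ e^{-2ws} e^{-s²} ds` of the half Gaussian. -/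
noncomputable def gaussLaplace (w : ℂ) : ℂ :=
  ∫ s in Ioi (0 : ℝ), Complex.exp (-2 * w * s - (s : ℂ) ^ 2)

/-- The entire extension of `Erfc`. -/
noncomputable def complexErfc (w : ℂ) : ℂ := Complex.exp (-w ^ 2) * gaussLaplace w

lemma integrable_gaussLaplace_kernel (w : ℂ) :
    Integrable fun s : ℝ => Complex.exp (-2 * w * s - (s : ℂ) ^ 2) := by
  have := integrable_cexp_quadratic (b := 1) (by simp) (-2 * w) 0
  refine this.congr (Eventually.of_forall fun s => ?_)
  simp only
  congr 1
  ring

lemma norm_gaussLaplace_kernel (w : ℂ) (s : ℝ) :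
    ‖Complex.exp (-2 * w * s - (s : ℂ) ^ 2)‖ = Real.exp (-2 * w.re * s - s ^ 2) := by
  rw [Complex.norm_exp]
  congr 1
  simp [← Complex.ofReal_pow]

lemma hasDerivAt_gaussLaplace (w : ℂ) :
    Integrable (fun s : ℝ => (-2 * s : ℂ) * Complex.exp (-2 * w * s - (s : ℂ) ^ 2))
      (volume.restrict (Ioi 0)) ∧
    HasDerivAt gaussLaplace
      (∫ s in Ioi (0 : ℝ), (-2 * s : ℂ) * Complex.exp (-2 * w * s - (s : ℂ) ^ 2)) w := by
  -- In the shift `‖w‖ + 2`, one unit covers the ball of radius 1 around `w`; the other absorbs the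
  -- factor `2s ≤ e^{2s}` produced by differentiation.
  have hb := (integrable_gaussLaplace_kernel ((-(‖w‖ + 2) : ℝ) : ℂ)).norm.restrict (s := Ioi 0)
  simp only [norm_gaussLaplace_kernel, Complex.ofReal_re] at hb
  refine hasDerivAt_integral_of_dominated_loc_of_deriv_le
    (F' := fun z s => (-2 * s : ℂ) * Complex.exp (-2 * z * s - (s : ℂ) ^ 2))
    (Metric.ball_mem_nhds w one_pos)
    (Eventually.of_forall fun z => (integrable_gaussLaplace_kernel z).restrict.aestronglyMeasurable)
    (integrable_gaussLaplace_kernel w).restrict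
    ?_ ?_ hb ?_
  · exact Continuous.aestronglyMeasurable (by fun_prop)
  · refine (ae_restrict_iff' measurableSet_Ioi).2 (Eventually.of_forall fun s hs z hz => ?_)
    have hs : 0 < s := hs
    have h1 : -z.re ≤ ‖w‖ + 1 := by
      have h2 := Complex.abs_re_le_norm z
      have h3 : ‖z‖ ≤ ‖w‖ + 1 := by
        have := norm_le_norm_add_norm_sub' z w
        rw [mem_ball_iff_norm] at hz
        linarith
      linarith [neg_abs_le z.re]
    rw [norm_mul, norm_gaussLaplace_kernel]
    have h4 : ‖(-2 * s : ℂ)‖ ≤ Real.exp (2 * s) := by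
      have : ‖(-2 * s : ℂ)‖ = 2 * s := by simp [abs_of_pos hs]
      rw [this]
      linarith [Real.add_one_le_exp (2 * s)]
    calc _ ≤ Real.exp (2 * s) * Real.exp (-2 * z.re * s - s ^ 2) := by gcongr
      _ = Real.exp (2 * s + (-2 * z.re * s - s ^ 2)) := (Real.exp_add _ _).symm
      _ ≤ _ := by
        apply Real.exp_le_exp.2
        nlinarith
  · refine Eventually.of_forall fun s z _ => ?_
    have : HasDerivAt (fun z : ℂ => -2 * z * s - (s : ℂ) ^ 2) (-2 * (s : ℂ)) z := by
      simpa using (((hasDerivAt_id z).const_mul (-2 : ℂ)).mul_const (s : ℂ)).sub_const ((s : ℂ) ^ 2)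
    simpa [mul_comm] using this.cexp

lemma differentiable_complexErfc : Differentiable ℂ complexErfc := fun w =>
  DifferentiableAt.mul (by fun_prop) (hasDerivAt_gaussLaplace w).2.differentiableAt

/-- Integrate the `s`-derivative of the kernel over the half line: the boundary terms are 0 at
infinity and 1 at the origin. -/
lemma two_mul_gaussLaplace_sub_one {w : ℂ} (hw : 0 < w.re) :
    2 * w * gaussLaplace w - 1 =
      ∫ s in Ioi (0 : ℝ), (-2 * s : ℂ) * Complex.exp (-2 * w * s - (s : ℂ) ^ 2) := by
  have hd : ∀ s : ℝ, HasDerivAt (fun s : ℝ => Complex.exp (-2 * w * s - (s : ℂ) ^ 2))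
      ((-2 * s : ℂ) * Complex.exp (-2 * w * s - (s : ℂ) ^ 2) -
        2 * w * Complex.exp (-2 * w * s - (s : ℂ) ^ 2)) s := by
    intro s
    have : HasDerivAt (fun z : ℂ => -2 * w * z - z ^ 2) (-2 * w - 2 * s) s := by
      convert! ((hasDerivAt_id (s : ℂ)).const_mul (-2 * w)).sub (hasDerivAt_pow 2 (s : ℂ)) using 1
      simp
    convert! this.cexp.comp_ofReal using 1
    ring
  have hi := (hasDerivAt_gaussLaplace w).1
  have hj : Integrable (fun s : ℝ => 2 * w * Complex.exp (-2 * w * s - (s : ℂ) ^ 2))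
    (volume.restrict (Ioi 0)) := (integrable_gaussLaplace_kernel w).restrict.const_mul (2 * w)
  have hlim : Tendsto (fun s : ℝ => Complex.exp (-2 * w * s - (s : ℂ) ^ 2)) atTop (𝓝 0) := by
    rw [tendsto_zero_iff_norm_tendsto_zero]
    simp only [norm_gaussLaplace_kernel]
    refine squeeze_zero' (Eventually.of_forall fun _ => (Real.exp_pos _).le) (g :=
      fun s => Real.exp (-(2 * w.re * s))) ?_
      (Real.tendsto_exp_neg_atTop_nhds_zero.comp (tendsto_id.const_mul_atTop (by positivity)))
    refine Eventually.of_forall fun s => Real.exp_le_exp.2 ?_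
    nlinarith [sq_nonneg s]
  have h := integral_Ioi_of_hasDerivAt_of_tendsto' (a := 0) (fun s _ => hd s) (hi.sub hj) hlim
  rw [integral_sub hi hj, integral_const_mul] at h
  simp only [Complex.ofReal_zero, mul_zero, ne_eq, OfNat.ofNat_ne_zero, not_false_eq_true,
    zero_pow, sub_zero, Complex.exp_zero] at h
  rw [gaussLaplace]
  linear_combination -h

/-- Leading-order asymptotics of `gaussLaplace` in the right half plane. -/
lemma norm_two_mul_gaussLaplace_sub_one_le {w : ℂ} (hw : 0 < w.re) :
    ‖2 * w * gaussLaplace w - 1‖ ≤ 1 / (2 * w.re ^ 2) := by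
  have hg := Real.integral_rpow_mul_exp_neg_mul_Ioi (a := 2) (r := 2 * w.re) (by norm_num)
    (by positivity)
  have hint : IntegrableOn (fun s : ℝ => s ^ ((2 : ℝ) - 1) * Real.exp (-(2 * w.re * s))) (Ioi 0) := by
    -- A non-integrable function has integral 0 by convention, against the positive Gamma value.
    by_contra hcon
    rw [integral_undef hcon] at hg
    have : 0 < (1 / (2 * w.re)) ^ (2 : ℝ) * Real.Gamma 2 := by positivity
    linarith
  rw [two_mul_gaussLaplace_sub_one hw]
  -- Dropping `e^{-s²} ≤ 1` leaves a Gamma integral that evaluates to the claimed bound.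
  have h1 : 1 / (2 * w.re ^ 2) =
      ∫ s in Ioi (0 : ℝ), 2 * (s ^ ((2 : ℝ) - 1) * Real.exp (-(2 * w.re * s))) := by
    rw [integral_const_mul, hg, Real.Gamma_two, Real.rpow_two]
    field_simp
  rw [h1]
  refine norm_integral_le_of_norm_le (hint.const_mul 2) ?_
  refine (ae_restrict_iff' measurableSet_Ioi).2 (Eventually.of_forall fun s hs => ?_)
  have hs : 0 < s := hs
  rw [norm_mul, norm_gaussLaplace_kernel, show (2 : ℝ) - 1 = 1 by norm_num, Real.rpow_one]
  have : ‖(-2 * s : ℂ)‖ = 2 * s := by simp [abs_of_pos hs]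
  rw [this, mul_assoc]
  gcongr
  nlinarith [sq_nonneg s]

lemma complexErfc_ofReal (t : ℝ) : complexErfc t = Erfc t := by
  have h : ∫ v in Ioi t, Real.exp (-v ^ 2) = ∫ s in Ioi (0 : ℝ), Real.exp (-(s + t) ^ 2) := by
    have := (measurePreserving_add_right volume t).setIntegral_preimage_emb
      (measurableEmbedding_addRight t) (fun v => Real.exp (-v ^ 2)) (Ioi t)
    rw [← this]
    simp
  rw [complexErfc, gaussLaplace, Erfc, h, ← integral_const_mul, ← integral_complex_ofReal]
  refine integral_congr_ae (Eventually.of_forall fun s => ?_)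
  simp only
  rw [← Complex.exp_add]
  push_cast
  congr 1
  ring

lemma integrable_exp_neg_sq : Integrable fun v : ℝ => Real.exp (-v ^ 2) := by
  simpa using integrable_exp_neg_mul_sq one_pos

lemma Erfc_nonneg (t : ℝ) : 0 ≤ Erfc t :=
  integral_nonneg fun _ => (Real.exp_pos _).le

lemma Erfc_zero : Erfc 0 = Real.sqrt Real.pi / 2 := by
  simpa [Erfc] using integral_gaussian_Ioi 1

lemma hasDerivAt_Erfc (t : ℝ) : HasDerivAt Erfc (-Real.exp (-t ^ 2)) t := by
  have h : Erfc = fun t => Erfc 0 - ∫ v in (0 : ℝ)..t, Real.exp (-v ^ 2) := by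
    funext t
    have := intervalIntegral.integral_Ioi_sub_Ioi' (a := 0) (b := t) (μ := volume)
      integrable_exp_neg_sq.integrableOn integrable_exp_neg_sq.integrableOn
    rw [← this]
    simp [Erfc]
  rw [h]
  have hc : Continuous fun v : ℝ => Real.exp (-v ^ 2) := by fun_prop
  exact (hc.integral_hasStrictDerivAt 0 t).hasDerivAt.const_sub _

/-! ### Vertical domains and holomorphic logarithms. -/

/-- The points that are joined to the real line by a vertical segment free of zeros of `F`. -/
def verticalDomain (F : ℂ → ℂ) : Set ℂ :=
  {z | ∀ t ∈ Icc (0 : ℝ) 1, F (z.re + t * z.im * Complex.I) ≠ 0}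

section VerticalDomain

variable {F : ℂ → ℂ}

lemma ne_zero_of_mem_verticalDomain {z : ℂ} (hz : z ∈ verticalDomain F) : F z ≠ 0 := by
  simpa using hz 1 (by simp)

lemma ofReal_mem_verticalDomain (hF : ∀ x : ℝ, F x ≠ 0) (x : ℝ) : (x : ℂ) ∈ verticalDomain F := by
  intro t _
  simpa using hF x

lemma isOpen_verticalDomain (hF : Continuous F) : IsOpen (verticalDomain F) := by
  rw [isOpen_iff_eventually]
  intro z hz
  refine isCompact_Icc.eventually_forall_of_forall_eventually fun t ht => ?_
  have hc : Continuous fun p : ℂ × ℝ => F (p.1.re + p.2 * p.1.im * Complex.I) := by fun_prop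
  exact hc.continuousAt.eventually_ne (hz t ht)

lemma isConnected_verticalDomain (hF : ∀ x : ℝ, F x ≠ 0) : IsConnected (verticalDomain F) := by
  have hR : IsConnected (range ((↑) : ℝ → ℂ)) := isConnected_range Complex.continuous_ofReal
  refine ⟨⟨_, ofReal_mem_verticalDomain hF 0⟩, isPreconnected_of_forall ((0 : ℝ) : ℂ) ?_⟩
  intro z hz
  have hv : IsPreconnected ((fun t : ℝ => (z.re + t * z.im * Complex.I : ℂ)) '' Icc 0 1) :=
    isPreconnected_Icc.image _ (by fun_prop)
  refine ⟨_, ?_, ?_, ?_, hR.isPreconnected.union (z.re : ℂ) (mem_range_self _) ?_ hv⟩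
  · rintro _ (⟨x, rfl⟩ | ⟨t, ht, rfl⟩)
    · exact ofReal_mem_verticalDomain hF x
    · intro s hs
      have := hz (s * t) ⟨mul_nonneg hs.1 ht.1, mul_le_one₀ hs.2 ht.1 ht.2⟩
      simpa [mul_assoc] using this
  · exact Or.inl (mem_range_self _)
  · exact Or.inr ⟨1, by simp, by simp⟩
  · exact ⟨0, by simp, by simp⟩

/-- A nonvanishing entire function that is positive on the real line has a holomorphic logarithm
on its vertical domain, real on the real line. -/
lemma exists_log_on_verticalDomain (hF : Differentiable ℂ F) {f : ℝ → ℝ}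
    (hf : ∀ x, 0 < f x) (hFf : ∀ x : ℝ, F x = f x) :
    ∃ L : ℂ → ℂ, DifferentiableOn ℂ L (verticalDomain F) ∧
      (∀ z ∈ verticalDomain F, Complex.exp (L z) = F z) ∧ ∀ x : ℝ, L x = Real.log (f x) := by
  classical
  have hF0 : ∀ x : ℝ, F x ≠ 0 := fun x => by
    rw [hFf]
    exact_mod_cast (hf x).ne'
  have hfc : Continuous f := by
    have : Continuous fun x : ℝ => (F x).re := by
      have := hF.continuous
      fun_prop
    simpa [hFf] using this
  set D := verticalDomain F with hD
  -- The homotopy slides from `F (Re z)` up to `F z`; lifting it through the covering `exp`,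
  -- starting at the real logarithm, defines the branch `L`.
  let H : C(unitInterval × D, {z : ℂ // z ≠ 0}) :=
    ⟨fun p => ⟨F ((p.2 : ℂ).re + (p.1 : ℝ) * (p.2 : ℂ).im * Complex.I), p.2.2 _ p.1.2⟩, by
      have := hF.continuous
      fun_prop⟩
  let l : C(D, ℂ) := ⟨fun z => (Real.log (f (z : ℂ).re) : ℂ), by
    refine Complex.continuous_ofReal.comp (Continuous.log ?_ fun z => (hf _).ne')
    fun_prop⟩
  have hexp : ∀ x, Complex.exp (Real.log (f x)) = F x := fun x => by
    rw [← Complex.ofReal_exp, Real.exp_log (hf x), hFf]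
  have h0 : ∀ a : D, H (0, a) = (⟨Complex.exp (l a), Complex.exp_ne_zero _⟩ : {z : ℂ // z ≠ 0}) := by
    intro a
    ext
    simp [H, l, hexp]
  let Λ := Complex.isCoveringMap_exp.liftHomotopy H l h0
  have hΛ : ∀ p, Complex.exp (Λ p) = (H p : ℂ) := fun p =>
    congrArg Subtype.val (congrFun (Complex.isCoveringMap_exp.liftHomotopy_lifts H l h0) p)
  have hΛreal : ∀ (x : ℝ) (hx : (x : ℂ) ∈ D) , Λ (1, ⟨x, hx⟩) = Real.log (f x) := by
    intro x hx
    -- Over a real point the homotopy is constant, so its lift stays at the real logarithm.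
    have hp : ∀ t, (H (t, ⟨x, hx⟩)) = H (0, ⟨x, hx⟩) := by
      intro t
      ext
      simp [H]
    have := Complex.isCoveringMap_exp.const_of_comp (g := fun t : unitInterval => Λ (t, ⟨x, hx⟩))
      (by fun_prop) (fun t t' => Subtype.ext ?_) 1 0
    · rw [this]
      exact Complex.isCoveringMap_exp.liftHomotopy_zero H l h0 ⟨x, hx⟩
    · simp only [hΛ, hp t, hp t']
  let L : ℂ → ℂ := fun z => if hz : z ∈ D then Λ (1, ⟨z, hz⟩) else 0
  have hLexp : ∀ z ∈ D, Complex.exp (L z) = F z := by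
    intro z hz
    simp only [L, dif_pos hz, hΛ]
    simp [H]
  have hLc : ContinuousOn L D := by
    rw [continuousOn_iff_continuous_domRestrict]
    have : Continuous fun z : D => Λ (1, z) := by fun_prop
    convert this using 2 with z
    simp [L]
  refine ⟨L, fun z hz => ?_, hLexp, fun x => ?_⟩
  · have hnhds : D ∈ 𝓝 z := (isOpen_verticalDomain hF.continuous).mem_nhds hz
    have hLz := hLc.continuousAt hnhds
    have him : ∀ᶠ y in 𝓝 z, ‖L y - L z‖ < Real.pi := by
      have : Tendsto (fun y => ‖L y - L z‖) (𝓝 z) (𝓝 0) := by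
        simpa using (hLz.tendsto.sub_const (L z)).norm
      exact this.eventually_lt_const Real.pi_pos
    -- By continuity `L y - L z` stays in the strip where the principal logarithm inverts `exp`, so
    -- holomorphy passes to `L`.
    have heq : L =ᶠ[𝓝 z] fun y => Complex.log (F y / F z) + L z := by
      filter_upwards [him, hnhds] with y hy hyD
      have hI := (Complex.abs_im_le_norm (L y - L z)).trans_lt hy
      rw [← hLexp y hyD, ← hLexp z hz, ← Complex.exp_sub,
        Complex.log_exp (neg_lt_of_abs_lt hI) (le_of_abs_le hI.le)]
      ring
    have hd : DifferentiableAt ℂ (fun y => Complex.log (F y / F z) + L z) z := by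
      refine (DifferentiableAt.clog ((hF z).div_const _) ?_).add_const _
      rw [div_self (ne_zero_of_mem_verticalDomain hz)]
      exact Complex.one_mem_slitPlane
    exact (heq.differentiableAt_iff.2 hd).differentiableWithinAt
  · have hx := ofReal_mem_verticalDomain hF0 x
    simp only [L, dif_pos (show (x : ℂ) ∈ D from hx)]
    exact hΛreal x hx

/-- The vertical domain of an entire function without real zeros is dense. -/
lemma dense_verticalDomain (hF : Differentiable ℂ F) (hF0 : ∀ x : ℝ, F x ≠ 0) :
    Dense (verticalDomain F) := by
  have hcod := (hF.differentiableOn.analyticOnNhd isOpen_univ).preimage_zero_mem_codiscrete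
    (hF0 0)
  have hdisc := (mem_codiscrete'.1 hcod).2
  -- The zero set is discrete and separable, hence countable; any abscissa outside its real parts
  -- gives a whole vertical line in the domain.
  have hcount : ((F ⁻¹' {0}ᶜ)ᶜ).Countable := by
    have := hdisc.to_subtype
    exact countable_coe_iff.1 (TopologicalSpace.separableSpace_iff_countable.1 inferInstance)
  have hdense := (hcount.image Complex.re).dense_compl ℝ
  intro z
  rw [Metric.mem_closure_iff]
  intro ε hε
  obtain ⟨x, hx, hxz⟩ := Metric.dense_iff.1 hdense z.re ε hε
  refine ⟨x + z.im * Complex.I, fun t _ h0 => hxz ⟨x + t * z.im * Complex.I, ?_, ?_⟩, ?_⟩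
  · simpa using h0
  · simp
  · have : z - (x + z.im * Complex.I) = ((z.re - x : ℝ) : ℂ) := by
      apply Complex.ext <;> simp
    rw [dist_eq_norm, this, Complex.norm_real, ← dist_eq_norm, dist_comm]
    exact hx

end VerticalDomain

/-! ### The bracket, the Bernoulli equation and the oscillator. -/

/-- The bracket in the definition of `oscSol`. -/
noncomputable def oscBracket (k : ℕ) (lam x : ℝ) : ℝ :=
  lam + Real.sqrt (2 * k - 2) * Erfc (Real.sqrt (((k : ℝ) - 1) / 2) * x)

/-- The entire extension of `oscBracket`. -/
noncomputable def complexOscBracket (k : ℕ) (lam : ℝ) (z : ℂ) : ℂ :=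
  lam + Real.sqrt (2 * k - 2) * complexErfc (Real.sqrt (((k : ℝ) - 1) / 2) * z)

section Oscillator

variable {k : ℕ} {lam : ℝ}

lemma oscSol_eq (k : ℕ) (lam x : ℝ) :
    oscSol k lam x = Real.exp (-x ^ 2 / 2) * oscBracket k lam x ^ (1 / (1 - (k : ℝ))) := rfl

lemma oscBracket_pos (hlam : 0 < lam) (x : ℝ) : 0 < oscBracket k lam x :=
  add_pos_of_pos_of_nonneg hlam (mul_nonneg (Real.sqrt_nonneg _) (Erfc_nonneg _))

lemma complexOscBracket_ofReal (x : ℝ) : complexOscBracket k lam x = oscBracket k lam x := by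
  rw [complexOscBracket, ← Complex.ofReal_mul, complexErfc_ofReal, oscBracket]
  push_cast
  rfl

lemma differentiable_complexOscBracket : Differentiable ℂ (complexOscBracket k lam) :=
  ((differentiable_complexErfc.comp (differentiable_id.const_mul _)).const_mul _).const_add _

lemma oscSol_pos (hlam : 0 < lam) (x : ℝ) : 0 < oscSol k lam x :=
  mul_pos (Real.exp_pos _) (Real.rpow_pos_of_pos (oscBracket_pos hlam x) _)

/-- This form contains no fractional power, so it continues analytically without a choice of branch.
-/
lemma oscSol_pow_mul_oscBracket (hk : 2 ≤ k) (hlam : 0 < lam) (x : ℝ) :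
    oscSol k lam x ^ (k - 1) * oscBracket k lam x = Real.exp (-((k : ℝ) - 1) * x ^ 2 / 2) := by
  have hB := oscBracket_pos (k := k) hlam x
  have hk' : (2 : ℝ) ≤ k := by exact_mod_cast hk
  have h1 : 1 - (k : ℝ) ≠ 0 := by linarith
  have hc : ((k - 1 : ℕ) : ℝ) = k - 1 := by push_cast [Nat.cast_sub (by omega : 1 ≤ k)]; ring
  rw [oscSol_eq, mul_pow, ← Real.exp_nat_mul, ← Real.rpow_natCast (_ ^ _), ← Real.rpow_mul hB.le, hc,
    show 1 / (1 - (k : ℝ)) * (k - 1) = -1 by field_simp; ring, Real.rpow_neg_one, mul_assoc,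
    inv_mul_cancel₀ hB.ne', mul_one]
  congr 1
  ring

lemma hasDerivAt_oscBracket (hk : 2 ≤ k) (x : ℝ) :
    HasDerivAt (oscBracket k lam)
      (-((k : ℝ) - 1) * Real.exp (-((k : ℝ) - 1) * x ^ 2 / 2)) x := by
  have hk' : (2 : ℝ) ≤ k := by exact_mod_cast hk
  have h0 : 0 ≤ ((k : ℝ) - 1) / 2 := by linarith
  have hs : Real.sqrt (2 * k - 2) = 2 * Real.sqrt (((k : ℝ) - 1) / 2) := by
    rw [show (2 * k - 2 : ℝ) = 2 ^ 2 * (((k : ℝ) - 1) / 2) by ring, Real.sqrt_mul (by positivity),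
      Real.sqrt_sq (by norm_num)]
  have h := (((hasDerivAt_Erfc (Real.sqrt (((k : ℝ) - 1) / 2) * x)).comp x
    ((hasDerivAt_id x).const_mul (Real.sqrt (((k : ℝ) - 1) / 2)))).const_mul
      (Real.sqrt (2 * k - 2))).const_add lam
  convert! h using 1
  rw [hs, mul_pow, Real.sq_sqrt h0,
    show -(((k : ℝ) - 1) / 2 * x ^ 2) = -((k : ℝ) - 1) * x ^ 2 / 2 by ring]
  linear_combination 2 * Real.exp (-((k : ℝ) - 1) * x ^ 2 / 2) * Real.sq_sqrt h0

/-- `oscSol` solves the Bernoulli equation `u' + x u = u ^ k`. -/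
lemma hasDerivAt_oscSol (hk : 2 ≤ k) (hlam : 0 < lam) (x : ℝ) :
    HasDerivAt (oscSol k lam) (oscSol k lam x ^ k - x * oscSol k lam x) x := by
  have hB := oscBracket_pos (k := k) hlam x
  have hk' : (2 : ℝ) ≤ k := by exact_mod_cast hk
  have h1 : 1 - (k : ℝ) ≠ 0 := by linarith
  have he : HasDerivAt (fun x : ℝ => Real.exp (-x ^ 2 / 2)) (Real.exp (-x ^ 2 / 2) * (-x)) x := by
    have : HasDerivAt (fun x : ℝ => -x ^ 2 / 2) (-x) x := by
      convert! ((hasDerivAt_pow 2 x).neg.div_const 2) using 1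
      simp
      ring
    exact this.exp
  have h := he.mul ((hasDerivAt_oscBracket (lam := lam) hk x).rpow_const (p := 1 / (1 - (k : ℝ)))
    (Or.inl hB.ne'))
  convert! h using 1
  have hp : oscSol k lam x ^ k = Real.exp (-x ^ 2 / 2) *
      (Real.exp (-((k : ℝ) - 1) * x ^ 2 / 2) * oscBracket k lam x ^ (1 / (1 - (k : ℝ)) - 1)) := by
    rw [oscSol_eq, mul_pow, ← Real.exp_nat_mul, ← Real.rpow_natCast (_ ^ _), ← Real.rpow_mul hB.le,
      ← mul_assoc, ← Real.exp_add]
    congr 2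
    · ring
    · field_simp
      ring
  rw [hp, oscSol_eq]
  field_simp
  ring

/-- The Bernoulli equation bootstraps regularity, and differentiating it once, then substituting for
`u'` in the term `x u'`, gives the second-order equation. -/
lemma solvesOscillator_oscSol (hk : 2 ≤ k) (hlam : 0 < lam) :
    SolvesOscillator k (oscSol k lam) := by
  have hd := hasDerivAt_oscSol (lam := lam) hk hlam
  have hderiv : deriv (oscSol k lam) = fun x => oscSol k lam x ^ k - x * oscSol k lam x :=
    funext fun x => (hd x).deriv
  have hdiff : Differentiable ℝ (oscSol k lam) := fun x => (hd x).differentiableAt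
  have h1 : ContDiff ℝ 1 (oscSol k lam) := by
    rw [contDiff_one_iff_deriv, hderiv]
    have := hdiff.continuous
    exact ⟨hdiff, by fun_prop⟩
  refine ⟨?_, fun x => ?_⟩
  · rw [show (2 : WithTop ℕ∞) = 1 + 1 by norm_num, contDiff_succ_iff_deriv, hderiv]
    exact ⟨hdiff, by simp, by fun_prop⟩
  · have h2 := (((hd x).fun_pow k).fun_sub ((hasDerivAt_id' x).fun_mul (hd x))).deriv
    rw [hderiv, h2, ((hd x).fun_pow k).deriv]
    ring

lemma lam_eq_oscSol_zero (hk : 2 ≤ k) (hlam : 0 < lam) :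
    lam = oscSol k lam 0 ^ (1 - (k : ℝ)) - Real.sqrt (Real.pi * ((k : ℝ) - 1) / 2) := by
  have hB := oscBracket_pos (k := k) hlam 0
  have hk' : (2 : ℝ) ≤ k := by exact_mod_cast hk
  have h1 : 1 - (k : ℝ) ≠ 0 := by linarith
  have hu : oscSol k lam 0 = oscBracket k lam 0 ^ (1 / (1 - (k : ℝ))) := by simp [oscSol_eq]
  rw [hu, ← Real.rpow_mul hB.le, one_div_mul_cancel h1, Real.rpow_one, oscBracket, mul_zero,
    Erfc_zero, show Real.pi * ((k : ℝ) - 1) / 2 = (2 * k - 2) * Real.pi / 2 ^ 2 by ring,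
    Real.sqrt_div' _ (by positivity), Real.sqrt_mul (by linarith), Real.sqrt_sq (by norm_num)]
  ring

/-! ### From zeros of the bracket to singularities. -/

/-- Zeros of the bracket are singularities. -/
lemma isSingularity_of_complexOscBracket_eq_zero (hk : 2 ≤ k) (hlam : 0 < lam) {z₀ : ℂ}
    (hz₀ : complexOscBracket k lam z₀ = 0) : IsSingularity (oscSol k lam) z₀ := by
  have hF := differentiable_complexOscBracket (k := k) (lam := lam)
  have hF0 : ∀ x : ℝ, complexOscBracket k lam x ≠ 0 := fun x => by
    rw [complexOscBracket_ofReal]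
    exact_mod_cast (oscBracket_pos hlam x).ne'
  constructor
  · obtain ⟨L, hL, -, hLreal⟩ := exists_log_on_verticalDomain hF
      (oscBracket_pos (k := k) hlam) complexOscBracket_ofReal
    refine ⟨verticalDomain (complexOscBracket k lam),
      fun z => Complex.exp (-z ^ 2 / 2) * Complex.exp (L z * (1 / (1 - (k : ℂ)))),
      ⟨isOpen_verticalDomain hF.continuous, isConnected_verticalDomain hF0,
        ofReal_mem_verticalDomain hF0, ?_, fun x => ?_⟩, dense_verticalDomain hF hF0 z₀⟩
    · exact DifferentiableOn.mul (by fun_prop) (hL.mul_const _).cexp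
    · rw [hLreal, oscSol_eq, Real.rpow_def_of_pos (oscBracket_pos hlam x)]
      push_cast
      rfl
  · intro D g hg hz₀D
    have hgD := hg.differentiableOn.analyticOnNhd hg.isOpen
    have hFD := hF.differentiableOn.analyticOnNhd hg.isOpen
    have hE : AnalyticOnNhd ℂ (fun z : ℂ => Complex.exp (-((k : ℂ) - 1) * z ^ 2 / 2)) D :=
      DifferentiableOn.analyticOnNhd (by fun_prop) hg.isOpen
    have hreal : ∀ x : ℝ, (g ^ (k - 1) * complexOscBracket k lam) x =
        Complex.exp (-((k : ℂ) - 1) * x ^ 2 / 2) := by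
      intro x
      rw [Pi.mul_apply, Pi.pow_apply, hg.eq_on_real, complexOscBracket_ofReal]
      exact_mod_cast congrArg ((↑) : ℝ → ℂ) (oscSol_pow_mul_oscBracket hk hlam x)
    have hlim : Tendsto ((↑) : ℝ → ℂ) (𝓝[≠] 0) (𝓝[≠] ((0 : ℝ) : ℂ)) :=
      Complex.continuous_ofReal.continuousWithinAt.tendsto_nhdsWithin
        fun x hx => by simpa using hx
    have heq := AnalyticOnNhd.eqOn_of_preconnected_of_frequently_eq ((hgD.pow (k - 1)).mul hFD) hE
      hg.isConnected.isPreconnected (hg.real_mem 0)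
      (hlim.frequently (Eventually.of_forall hreal).frequently) hz₀D
    simp only [hz₀, mul_zero] at heq
    exact Complex.exp_ne_zero _ heq.symm

end Oscillator

/-! ### Roots of `complexErfc w = -a` near the diagonal. -/

/-- In a sector inside the right half plane, far from the origin, `gaussLaplace w` is close to
`1 / (2 w)`. -/
lemma gaussLaplace_bounds {w : ℂ} (h1 : 5 ≤ w.re) (h2 : ‖w‖ ≤ 4 * w.re) :
    0 < (gaussLaplace w).re ∧ ‖gaussLaplace w‖ * ‖w‖ ≤ 1 ∧ 1 ≤ 4 * ‖w‖ * ‖gaussLaplace w‖ := by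
  have hw : 0 < w.re := by linarith
  have hw0 : w ≠ 0 := fun h => by simp [h] at hw
  have hn : 0 < ‖w‖ := norm_pos_iff.2 hw0
  have hη : ‖2 * w * gaussLaplace w - 1‖ ≤ 1 / 50 := by
    refine (norm_two_mul_gaussLaplace_sub_one_le hw).trans ?_
    rw [div_le_div_iff₀ (by positivity) (by norm_num)]
    nlinarith
  set η := 2 * w * gaussLaplace w - 1 with hηdef
  have hnorm : ‖1 + η‖ = 2 * (‖w‖ * ‖gaussLaplace w‖) := by
    rw [hηdef]
    simp [mul_assoc]
  have hu := norm_add_le 1 η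
  have hl := norm_sub_le (1 + η) η
  rw [add_sub_cancel_right, norm_one] at hl
  rw [norm_one] at hu
  refine ⟨?_, by linarith, by linarith⟩
  -- This is `2|w|² G = (1 + η) w̄`; as `|η| ≤ 1/50` and `‖w‖ ≤ 4 Re w`, the error cannot change the
  -- sign of the real part.
  have hG : ((2 * Complex.normSq w : ℝ) : ℂ) * gaussLaplace w =
      (starRingEnd ℂ) w + η * (starRingEnd ℂ) w := by
    rw [Complex.ofReal_mul, Complex.normSq_eq_conj_mul_self, hηdef]
    push_cast
    ring
  have hre := congrArg Complex.re hG
  rw [Complex.re_ofReal_mul, Complex.add_re, Complex.conj_re] at hre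
  have hb : |(η * (starRingEnd ℂ) w).re| ≤ 1 / 50 * ‖w‖ := by
    refine (Complex.abs_re_le_norm _).trans ?_
    rw [norm_mul, Complex.norm_conj]
    gcongr
  have hpos : 0 < 2 * Complex.normSq w * (gaussLaplace w).re := by
    linarith [neg_abs_le (η * (starRingEnd ℂ) w).re]
  have hns : 0 < 2 * Complex.normSq w := by
    have := Complex.normSq_pos.2 hw0
    positivity
  exact (pos_iff_pos_of_mul_pos hpos).1 hns

/-- The unit vector `e^{iπ/4}`. -/
noncomputable def diagonalUnit : ℂ := ⟨Real.sqrt 2 / 2, Real.sqrt 2 / 2⟩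

lemma diagonalUnit_sq : diagonalUnit ^ 2 = Complex.I := by
  have := Real.mul_self_sqrt (show (0 : ℝ) ≤ 2 by norm_num)
  apply Complex.ext <;> simp [diagonalUnit, pow_two]
  linarith

lemma norm_diagonalUnit : ‖diagonalUnit‖ = 1 := by
  have h : ‖diagonalUnit‖ ^ 2 = 1 := by rw [← norm_pow, diagonalUnit_sq, Complex.norm_I]
  exact (pow_eq_one_iff_of_nonneg (norm_nonneg _) two_ne_zero).1 h

lemma Complex.arg_eq_arctan_of_re_pos {w : ℂ} (hw : 0 < w.re) :
    w.arg = Real.arctan (w.im / w.re) := by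
  have h := abs_lt.1 (Complex.abs_arg_lt_pi_div_two_iff.2 (Or.inl hw))
  rw [← Complex.tan_arg, Real.arctan_tan h.1 h.2]

lemma arg_diagonalUnit : diagonalUnit.arg = Real.pi / 4 := by
  have : 0 < diagonalUnit.re := by simp [diagonalUnit]
  rw [Complex.arg_eq_arctan_of_re_pos this, diagonalUnit, div_self (by positivity), Real.arctan_one]

lemma bounds_near_diagonal {R : ℝ} (hR : 10 ≤ R) {w : ℂ} (hw : ‖w - R * diagonalUnit‖ ≤ 2) :
    R / 2 ≤ w.re ∧ ‖w‖ ≤ R + 2 ∧ R - 2 ≤ ‖w‖ := by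
  have hn : ‖R * diagonalUnit‖ = R := by
    rw [norm_mul, norm_diagonalUnit, Complex.norm_real, mul_one, Real.norm_of_nonneg (by linarith)]
  refine ⟨?_, ?_, ?_⟩
  · have h1 := (abs_le.1 ((Complex.abs_re_le_norm _).trans hw)).1
    rw [Complex.sub_re, Complex.re_ofReal_mul] at h1
    have h2 : (1.4 : ℝ) ≤ Real.sqrt 2 := Real.le_sqrt_of_sq_le (by norm_num)
    simp only [diagonalUnit] at h1
    nlinarith
  · linarith [norm_le_norm_add_norm_sub' w (R * diagonalUnit)]
  · linarith [norm_le_norm_add_norm_sub w (R * diagonalUnit)]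

/-- `complexErfc` takes the value `-a` near the points `R e^{iπ/4}` with `e^{i R²} = -1`. -/
lemma exists_complexErfc_eq_neg {a R : ℝ} (ha : 0 < a) (hR : 10 ≤ R)
    (hRa : 2 + 3 * (Real.log 32 + |Real.log a| + Real.pi) ≤ R)
    (hexp : Complex.exp (-((R : ℂ) ^ 2 * Complex.I)) = -1) :
    ∃ w : ℂ, ‖w - R * diagonalUnit‖ ≤ 1 ∧ complexErfc w = -a := by
  set w₀ : ℂ := R * diagonalUnit with hw₀
  set M : ℝ := Real.log (4 * (R + 2)) + |Real.log a| + Real.pi with hM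
  -- The inequality `log x ≤ x - 1` at `x = (R+2)/8` gives a slope small enough for `4M < 2R - 1`;
  -- the rescaling is the source of `log 32`.
  have hlog : Real.log (4 * (R + 2)) ≤ (R + 2) / 8 - 1 + Real.log 32 := by
    have h := Real.log_le_sub_one_of_pos (show 0 < (R + 2) / 8 by linarith)
    rw [show 4 * (R + 2) = (R + 2) / 8 * 32 by ring, Real.log_mul (by linarith) (by norm_num)]
    linarith
  have hMR : 4 * M < 2 * R - 1 := by
    rw [hM]
    have : 0 < Real.log 32 := Real.log_pos (by norm_num)
    linarith [abs_nonneg (Real.log a), Real.pi_pos]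
  have hG : ∀ w : ℂ, ‖w - w₀‖ ≤ 2 → 0 < (gaussLaplace w).re ∧ ‖gaussLaplace w‖ * ‖w‖ ≤ 1 ∧
      1 ≤ 4 * ‖w‖ * ‖gaussLaplace w‖ := by
    intro w hw
    obtain ⟨h1, h2, -⟩ := bounds_near_diagonal hR hw
    exact gaussLaplace_bounds (by linarith) (by linarith)
  -- Positivity of `Re G` keeps the principal logarithm holomorphic on the whole disc.
  have hslit : ∀ w : ℂ, ‖w - w₀‖ ≤ 2 → gaussLaplace w / a ∈ Complex.slitPlane := by
    intro w hw
    refine Or.inl ?_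
    rw [Complex.div_ofReal_re]
    exact div_pos (hG w hw).1 ha
  have hlogG : ∀ w : ℂ, ‖w - w₀‖ ≤ 2 → ‖Complex.log (gaussLaplace w / a)‖ ≤ M := by
    intro w hw
    obtain ⟨h1, h2, h3⟩ := hG w hw
    obtain ⟨b1, b2, b3⟩ := bounds_near_diagonal hR hw
    have hg : 0 < ‖gaussLaplace w‖ := norm_pos_iff.2 fun h => by simp [h] at h1
    refine (Complex.norm_le_abs_re_add_abs_im _).trans (add_le_add ?_ ?_)
    · rw [Complex.log_re, norm_div, Complex.norm_real, Real.norm_of_nonneg ha.le,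
        Real.log_div hg.ne' ha.ne']
      refine (abs_sub _ _).trans (add_le_add_left (abs_le.2 ⟨?_, ?_⟩) _)
      · rw [neg_le, ← Real.log_inv]
        refine Real.log_le_log (by positivity) ?_
        rw [inv_le_iff_one_le_mul₀ hg]
        nlinarith
      · refine Real.log_le_log hg ?_
        nlinarith
    · rw [Complex.log_im]
      exact Complex.abs_arg_le_pi _
  let Φ : ℂ → ℂ := fun w => w ^ 2 - Complex.log (gaussLaplace w / a)
  have hΦ : DifferentiableOn ℂ Φ (Metric.ball w₀ 2) := by
    intro w hw
    rw [mem_ball_iff_norm] at hw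
    refine DifferentiableAt.differentiableWithinAt ?_
    exact (differentiableAt_id.pow 2).sub
      (((hasDerivAt_gaussLaplace w).2.differentiableAt.div_const _).clog (hslit w hw.le))
  have hcenter : ‖w₀ - w₀‖ ≤ 2 := by simp
  have hsphere : ∀ w ∈ Metric.sphere w₀ 1, 2 * R - 1 - 2 * M ≤ ‖Φ w - Φ w₀‖ := by
    intro w hw
    rw [mem_sphere_iff_norm] at hw
    have e : w ^ 2 - w₀ ^ 2 = (Φ w - Φ w₀) + Complex.log (gaussLaplace w / a) -
        Complex.log (gaussLaplace w₀ / a) := by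
      simp only [Φ]
      ring
    have h1 : 2 * R - 1 ≤ ‖w ^ 2 - w₀ ^ 2‖ := by
      have hn : ‖w₀‖ = R := by
        rw [hw₀, norm_mul, norm_diagonalUnit, Complex.norm_real, mul_one,
          Real.norm_of_nonneg (by linarith)]
      have h2 : 2 * w₀ = (w + w₀) - (w - w₀) := by ring
      have h3 := norm_sub_le (w + w₀) (w - w₀)
      rw [← h2, norm_mul, hn, hw, Complex.norm_ofNat] at h3
      rw [sq_sub_sq, norm_mul, hw]
      linarith
    rw [e] at h1
    have h4 := norm_sub_le ((Φ w - Φ w₀) + Complex.log (gaussLaplace w / a))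
      (Complex.log (gaussLaplace w₀ / a))
    have h5 := norm_add_le (Φ w - Φ w₀) (Complex.log (gaussLaplace w / a))
    linarith [hlogG w (by linarith), hlogG w₀ hcenter]
  have hM0 : 0 ≤ M := (norm_nonneg _).trans (hlogG w₀ hcenter)
  have hne : ∃ᶠ w in 𝓝 w₀, Φ w ≠ Φ w₀ := by
    intro hev
    simp only [ne_eq, not_not] at hev
    have heq := (hΦ.analyticOnNhd Metric.isOpen_ball).eqOn_of_preconnected_of_eventuallyEq
      analyticOnNhd_const (convex_ball w₀ 2).isPreconnected (Metric.mem_ball_self two_pos) hev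
    have hmem : w₀ + 1 ∈ Metric.ball w₀ 2 := by simp
    have h := hsphere (w₀ + 1) (by simp)
    rw [heq hmem, sub_self, norm_zero] at h
    linarith
  have hcl : DiffContOnCl ℂ Φ (Metric.ball w₀ 1) :=
    (hΦ.mono (Metric.closedBall_subset_ball (by norm_num))).diffContOnCl_ball subset_rfl
  -- The open mapping theorem covers a ball of half the lower bound on the circle. The target misses
  -- `Φ w₀` by at most `M`, and `4M < 2R - 1` puts it inside.
  have htarget : (R : ℂ) ^ 2 * Complex.I ∈ Metric.ball (Φ w₀) ((2 * R - 1 - 2 * M) / 2) := by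
    have : (R : ℂ) ^ 2 * Complex.I - Φ w₀ = Complex.log (gaussLaplace w₀ / a) := by
      simp only [Φ, hw₀, mul_pow, diagonalUnit_sq]
      ring
    rw [mem_ball_iff_norm, this]
    linarith [hlogG w₀ hcenter]
  obtain ⟨w, hw, hwΦ⟩ := hcl.ball_subset_image_closedBall one_pos hsphere hne htarget
  rw [mem_closedBall_iff_norm] at hw
  refine ⟨w, hw, ?_⟩
  have ha0 : (a : ℂ) ≠ 0 := by exact_mod_cast ha.ne'
  have hlogexp := Complex.exp_log (Complex.slitPlane_ne_zero (hslit w (by linarith)))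
  have hl : Complex.log (gaussLaplace w / a) = w ^ 2 + -((R : ℂ) ^ 2 * Complex.I) := by
    rw [← hwΦ]
    simp only [Φ]
    ring
  rw [hl, Complex.exp_add, hexp, eq_div_iff ha0] at hlogexp
  rw [complexErfc, ← hlogexp, Complex.exp_neg]
  field_simp [Complex.exp_ne_zero]

/-- Solutions of `complexErfc w = -a` in the right half plane lie above the diagonal. -/
lemma pi_div_four_lt_arg {a R : ℝ} (ha : 0 < a) (hR : 10 ≤ R) (hRa : 2 + 1 / a < R) {w : ℂ}
    (hw : ‖w - R * diagonalUnit‖ ≤ 1) (hE : complexErfc w = -a) : Real.pi / 4 < w.arg := by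
  obtain ⟨h1, h2, h3⟩ := bounds_near_diagonal hR (hw.trans (by norm_num))
  have hre : 0 < w.re := by linarith
  obtain ⟨-, hG, -⟩ := gaussLaplace_bounds (w := w) (by linarith) (by linarith)
  have him : 0 < w.im := by
    have h4 := (abs_le.1 ((Complex.abs_im_le_norm _).trans hw)).1
    rw [Complex.sub_im, Complex.im_ofReal_mul] at h4
    have h5 : (1.4 : ℝ) ≤ Real.sqrt 2 := Real.le_sqrt_of_sq_le (by norm_num)
    simp only [diagonalUnit] at h4
    nlinarith
  have hnorm : Real.exp (-(w ^ 2).re) * ‖gaussLaplace w‖ = a := by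
    have := congrArg norm hE
    rwa [complexErfc, norm_mul, Complex.norm_exp, norm_neg, Complex.norm_real,
      Real.norm_of_nonneg ha.le, Complex.neg_re] at this
  have haw : 1 < a * ‖w‖ := by
    have : 1 / a < ‖w‖ := by linarith
    rwa [div_lt_iff₀' ha] at this
  have hgt : 1 < Real.exp (-(w ^ 2).re) := by
    refine haw.trans_le ?_
    rw [← hnorm, mul_assoc]
    exact mul_le_of_le_one_right (Real.exp_pos _).le hG
  have hsq : (w ^ 2).re < 0 := by
    have := Real.one_lt_exp_iff.1 hgt
    linarith
  have hlt : w.re < w.im := by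
    rw [pow_two, Complex.mul_re] at hsq
    nlinarith
  rw [Complex.arg_eq_arctan_of_re_pos hre, ← Real.arctan_one]
  exact Real.arctan_strictMono ((one_lt_div hre).2 hlt)

lemma exists_complexErfc_eq_neg_in_sector {a ε : ℝ} (ha : 0 < a) (hε : 0 < ε) :
    ∃ R₀ : ℝ, ∀ R : ℝ, R₀ ≤ R → Complex.exp (-((R : ℂ) ^ 2 * Complex.I)) = -1 →
      ∃ w : ℂ, complexErfc w = -a ∧ Real.pi / 4 < w.arg ∧ w.arg < Real.pi / 4 + ε ∧
        R - 2 ≤ ‖w‖ := by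
  have hslit : diagonalUnit ∈ Complex.slitPlane := Or.inl (by simp [diagonalUnit])
  have hev := (Complex.continuousAt_arg hslit).eventually_lt_const
    (show diagonalUnit.arg < Real.pi / 4 + ε by rw [arg_diagonalUnit]; linarith)
  obtain ⟨δ, hδ, hball⟩ := Metric.eventually_nhds_iff_ball.1 hev
  -- The bound `1 + 1/δ` puts `w / R` within `δ` of `e^{iπ/4}`, where the argument is below `π/4 +
  -- ε`; the other entries feed the existence of the root and its position above the diagonal.
  refine ⟨max 10 (max (2 + 3 * (Real.log 32 + |Real.log a| + Real.pi))
    (max (3 + 1 / a) (1 + 1 / δ))), fun R hR hexp => ?_⟩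
  simp only [max_le_iff] at hR
  obtain ⟨h1, h2, h3, h4⟩ := hR
  have hR0 : 0 < R := by linarith
  obtain ⟨w, hw, hE⟩ := exists_complexErfc_eq_neg ha h1 h2 hexp
  refine ⟨w, hE, pi_div_four_lt_arg ha h1 (by linarith) hw hE, ?_,
    (bounds_near_diagonal h1 (hw.trans (by norm_num))).2.2⟩
  have hRC : (R : ℂ) ≠ 0 := by exact_mod_cast hR0.ne'
  have hmem : ((R⁻¹ : ℝ) : ℂ) * w ∈ Metric.ball diagonalUnit δ := by
    have e : ((R⁻¹ : ℝ) : ℂ) * w - diagonalUnit = ((R⁻¹ : ℝ) : ℂ) * (w - R * diagonalUnit) := by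
      push_cast
      field_simp
    rw [mem_ball_iff_norm, e, norm_mul, Complex.norm_real, Real.norm_of_nonneg (by positivity),
      inv_mul_lt_iff₀ hR0]
    have : 1 / δ < R := by linarith
    rw [div_lt_iff₀ hδ] at this
    linarith
  have := hball _ hmem
  rwa [Complex.arg_real_mul _ (inv_pos.2 hR0)] at this

/-! ### The sequence of singularities and the conclusion. -/

lemma hasSingularitiesToInfinity_oscSol {k : ℕ} (hk : 2 ≤ k) {lam ε : ℝ} (hlam : 0 < lam)
    (hε : 0 < ε) :
    HasSingularitiesToInfinity (oscSol k lam) (Real.pi / 4) (Real.pi / 4 + ε) := by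
  have hk' : (2 : ℝ) ≤ k := by exact_mod_cast hk
  have hb : 0 < Real.sqrt (2 * k - 2) := Real.sqrt_pos.2 (by linarith)
  have hs : 0 < Real.sqrt (((k : ℝ) - 1) / 2) := Real.sqrt_pos.2 (by linarith)
  set b := Real.sqrt (2 * k - 2)
  set s := Real.sqrt (((k : ℝ) - 1) / 2)
  obtain ⟨R₀, hR₀⟩ := exists_complexErfc_eq_neg_in_sector (div_pos hlam hb) hε
  -- These radii satisfy `R² = (2n+1)π`, hence `e^{-iR²} = -1`. Dividing the roots by `s > 0` later
  -- returns to the variable `z` without changing arguments.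
  let R : ℕ → ℝ := fun n => Real.sqrt ((2 * n + 1) * Real.pi)
  have hRsq : ∀ n, Complex.exp (-((R n : ℂ) ^ 2 * Complex.I)) = -1 := by
    intro n
    have : R n ^ 2 = (2 * n + 1) * Real.pi := Real.sq_sqrt (by positivity)
    rw [← Complex.ofReal_pow, this, Complex.exp_neg]
    push_cast
    rw [show (2 * (n : ℂ) + 1) * Real.pi * Complex.I =
      Real.pi * Complex.I + n * (2 * Real.pi * Complex.I) by ring, Complex.exp_add,
      Complex.exp_nat_mul_two_pi_mul_I, Complex.exp_pi_mul_I]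
    norm_num
  have hRlim : Tendsto R atTop atTop := by
    refine Real.tendsto_sqrt_atTop.comp (Tendsto.atTop_mul_const Real.pi_pos ?_)
    exact tendsto_atTop_add_const_right _ _
      (tendsto_natCast_atTop_atTop.const_mul_atTop two_pos)
  obtain ⟨N, hN⟩ := eventually_atTop.1 (hRlim.eventually_ge_atTop R₀)
  choose w hE h1 h2 h3 using fun n : ℕ => hR₀ (R (n + N)) (hN _ (by omega)) (hRsq _)
  refine ⟨fun n => ((s⁻¹ : ℝ) : ℂ) * w n, fun n => ⟨?_, ?_, ?_⟩, ?_⟩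
  · apply isSingularity_of_complexOscBracket_eq_zero hk hlam
    have hsC : (s : ℂ) ≠ 0 := by exact_mod_cast hs.ne'
    have hbC : (b : ℂ) ≠ 0 := by exact_mod_cast hb.ne'
    change (lam : ℂ) + b * complexErfc (s * (((s⁻¹ : ℝ) : ℂ) * w n)) = 0
    rw [Complex.ofReal_inv, mul_inv_cancel_left₀ hsC, hE]
    push_cast
    field_simp
    ring
  · rw [Complex.arg_real_mul _ (inv_pos.2 hs)]
    exact h1 n
  · rw [Complex.arg_real_mul _ (inv_pos.2 hs)]
    exact h2 n
  · simp only [norm_mul, Complex.norm_real, Real.norm_of_nonneg (inv_pos.2 hs).le]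
    refine Tendsto.const_mul_atTop (inv_pos.2 hs) (tendsto_atTop_mono h3 ?_)
    exact tendsto_atTop_add_const_right _ _ (hRlim.comp (tendsto_add_atTop_nat N))

theorem proposition5p1 (k : ℕ) (hk : 2 ≤ k) :
    (∀ lam : ℝ, 0 < lam →
      SolvesOscillator k (oscSol k lam) ∧ 0 < oscSol k lam 0 ∧
        lam = oscSol k lam 0 ^ (1 - (k : ℝ)) - Real.sqrt (Real.pi * ((k : ℝ) - 1) / 2)) ∧
    ∃ lam₀ : ℝ, ∀ lam : ℝ, 0 < lam → lam ≠ lam₀ → ∀ ε : ℝ, 0 < ε →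
      HasSingularitiesToInfinity (oscSol k lam) (Real.pi / 4) (Real.pi / 4 + ε) ∨
        HasSingularitiesToInfinity (oscSol k lam) (3 * Real.pi / 4 - ε) (3 * Real.pi / 4) :=
  ⟨fun _ hlam => ⟨solvesOscillator_oscSol hk hlam, oscSol_pos hlam 0, lam_eq_oscSol_zero hk hlam⟩,
    -- The exceptional value 0 excludes no positive `lam`.
    0, fun _ hlam _ _ hε => Or.inl (hasSingularitiesToInfinity_oscSol hk hlam hε)⟩
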